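/- Let $n\ge 1$. For a measurable function $f$ on $\mathbb R^n$ let $$M_{\mathrm S}f(x)=\sup_{R\ni x}\frac1{|R|}\int_R|f|$$ be the strong maximal function, where the supremum is over all nonempty bounded open rectangular parallelepipeds $R\subset\mathbb R^n$ containing $x$ with sides parallel to the coordinate axes, and $|\cdot|$ is Lebesgue measure. Let $\phi_{\mathrm S}$ be the halo function of $M_{\mathrm S}$: $$\phi_{\mathrm S}(\alpha)=\sup_{E}\frac{1}{|E|}\left|\left\{x\in\mathbb R^n: M_{\mathrm S}\chi_E(x)>\tfrac1\alpha\right\}\right|\quad\text{for }\alpha>1,$$ where the supremum is over all measurable $E\subset\mathbb R^n$ with $0<|E|<\infty$, and $\phi_{\mathrm S}(\alpha)=\alpha$ for $0\le\alpha\le1$. Then $\phi_{\mathrm S}$ is finite on $[0,\infty)$ and $\phi_{\mathrm S}\in C^{1/n}([0,\infty))$; that is, for every compact set $K\subset[0,\infty)$ there is a constant $C_{n,K}<\infty$ such that $$|\phi_{\mathrm S}(x)-\phi_{\mathrm S}(y)|\le C_{n,K}\,|x-y|^{1/n}\qquad\text{for all }x,y\in K.$$ -/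

import Mathlib

open MeasureTheory Set
open scoped ENNReal NNReal

noncomputable section

/-- The maximal operator `M_B f (x) = sup_{x ∈ R ∈ B} |R|⁻¹ ∫_R |f|` associated with a collection
`B` of subsets of `ℝⁿ`, with values in `[0, ∞]`; it is `0` at points covered by no member of `B`. -/
def maximalOperator {n : ℕ} (B : Set (Set (Fin n → ℝ))) (f : (Fin n → ℝ) → ℝ)
    (x : Fin n → ℝ) : ℝ≥0∞ :=
  ⨆ R ∈ {R ∈ B | x ∈ R}, (∫⁻ y in R, ‖f y‖ₑ) / volume R

/-- The halo set `{x : M_B χ_E (x) > t}`. -/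
def haloSet {n : ℕ} (B : Set (Set (Fin n → ℝ))) (t : ℝ) (E : Set (Fin n → ℝ)) :
    Set (Fin n → ℝ) :=
  {x | ENNReal.ofReal t < maximalOperator B (E.indicator fun _ => (1 : ℝ)) x}

/-- The halo function of `B`, with values in `[0, ∞]`: for `α > 1` it is the supremum of
`|{x : M_B χ_E (x) > 1 / α}| / |E|` over all measurable `E` with `0 < |E| < ∞`, and it is `α`
for `α ∈ [0, 1]`. (Arguments `α < 0` are irrelevant.) -/
def haloFunction {n : ℕ} (B : Set (Set (Fin n → ℝ))) (α : ℝ) : ℝ≥0∞ :=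
  if 1 < α then
    ⨆ E ∈ {E : Set (Fin n → ℝ) | MeasurableSet E ∧ 0 < volume E ∧ volume E < ∞},
      volume (haloSet B (1 / α) E) / volume E
  else ENNReal.ofReal α

/-- All (bounded, open, nonempty) rectangular parallelepipeds in `ℝⁿ` with sides parallel to the
coordinate axes: the basis of the strong maximal operator. -/
def strongBasis (n : ℕ) : Set (Set (Fin n → ℝ)) :=
  {R | ∃ a b : Fin n → ℝ, (∀ i, a i < b i) ∧ R = Set.univ.pi fun i => Set.Ioo (a i) (b i)}

/-- The Hölder class `C^p(I)`: on every compact `K ⊆ I` one has `|f x - f y| ≤ C_K |x - y| ^ p`. -/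
def LocallyHolderOn (p : ℝ≥0) (f : ℝ → ℝ) (I : Set ℝ) : Prop :=
  ∀ K ⊆ I, IsCompact K → ∃ C : ℝ≥0, HolderOnWith C p f K

end

/-!
The proof rests on a Solyanik estimate. Adjoin to `E` all intervals `I` with `|I \ E| < e |I|`; a
finite family of intervals has a subfamily with the same union in which no point is covered more
than twice, so for `e ≤ 1/2` the measure of `E` grows at most by the factor `1 + O(e)`. Applying
this one coordinate at a time, adjoining to `E ⊆ ℝⁿ` the boxes `R` with `|R \ E| < e ^ n |R|`
multiplies `|E|` by at most `1 + O(e)`. With `η = e ^ n` this factor is `1 + O(η ^ (1 / n))`.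

Let `E'` be the set so obtained from `E` with `η = 2 δ`, and let `R` be a box with
`|R \ E| ≥ δ |R|`. Almost every point of `R ∩ E` is the centre of a homothetic copy `Q ⊆ R` of `R`
with `|Q \ E| = δ |Q|`, and `Q ⊆ E'`. Vitali's covering lemma, which for homothetic copies holds
with a constant `K` independent of the eccentricity of `R`, gives
`δ |R ∩ E| ≤ K |(R ∩ E') \ E|`, that is, `(1 + δ / K) |R ∩ E| ≤ |R ∩ E'|`. Thus
`{M χ_E > 1 / (α (1 + δ / K))} ⊆ {M χ_E' > 1 / α}` and the halo function satisfies
`φ(α (1 + δ / K)) ≤ (1 + O(δ ^ (1 / n))) φ(α)`, which yields both finiteness and Hölder continuity.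
-/

section BoundedOverlap

lemma ordConnected_inter_Iic_subset_or_subset {α : Type*} [LinearOrder α] {I J : Set α}
    (hI : I.OrdConnected) (hJ : J.OrdConnected) {x : α} (hxI : x ∈ I) (hxJ : x ∈ J) :
    I ∩ Iic x ⊆ J ∩ Iic x ∨ J ∩ Iic x ⊆ I ∩ Iic x := by
  by_contra! h
  obtain ⟨⟨y, ⟨hyI, hyx⟩, hyJ⟩, ⟨z, ⟨hzJ, hzx⟩, hzI⟩⟩ :=
    And.intro (not_subset.1 h.1) (not_subset.1 h.2)
  rcases le_total y z with hyz | hzy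
  · exact hzI ⟨hI.out hyI hxI ⟨hyz, hzx⟩, hzx⟩
  · exact hyJ ⟨hJ.out hzJ hxJ ⟨hzy, hyx⟩, hyx⟩

lemma exists_forall_inter_Iic_subset {α : Type*} [LinearOrder α] {u : Finset (Set α)}
    (hu : ∀ I ∈ u, I.OrdConnected) (hne : u.Nonempty) {x : α} (hx : ∀ I ∈ u, x ∈ I) :
    ∃ L ∈ u, ∀ I ∈ u, I ∩ Iic x ⊆ L ∩ Iic x := by
  obtain ⟨L, hL, hmax⟩ := u.exists_maximalFor (· ∩ Iic x) hne
  exact ⟨L, hL, fun I hI => (ordConnected_inter_Iic_subset_or_subset (hu I hI) (hu L hL)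
    (hx I hI) (hx L hL)).elim id fun h => hmax hI h⟩

lemma exists_forall_inter_Ici_subset {α : Type*} [LinearOrder α] {u : Finset (Set α)}
    (hu : ∀ I ∈ u, I.OrdConnected) (hne : u.Nonempty) {x : α} (hx : ∀ I ∈ u, x ∈ I) :
    ∃ R ∈ u, ∀ I ∈ u, I ∩ Ici x ⊆ R ∩ Ici x :=
  exists_forall_inter_Iic_subset (α := αᵒᵈ) (fun I hI => (hu I hI).dual) hne hx

open scoped Classical in
lemma exists_subset_sUnion_eq_card_le_two {α : Type*} [LinearOrder α] (s : Finset (Set α))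
    (hs : ∀ I ∈ s, I.OrdConnected) :
    ∃ t ⊆ s, ⋃₀ (t : Set (Set α)) = ⋃₀ s ∧ ∀ x, (t.filter (x ∈ ·)).card ≤ 2 := by
  induction s using Finset.strongInduction with
  | H s ih =>
    by_cases hcard : ∀ x, (s.filter (x ∈ ·)).card ≤ 2
    · exact ⟨s, subset_rfl, rfl, hcard⟩
    push Not at hcard
    obtain ⟨x, hcard⟩ := hcard
    have hxmem : ∀ I ∈ s.filter (x ∈ ·), x ∈ I := fun I hI => (Finset.mem_filter.1 hI).2
    have hconn : ∀ I ∈ s.filter (x ∈ ·), I.OrdConnected :=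
      fun I hI => hs I (Finset.mem_filter.1 hI).1
    have hne : (s.filter (x ∈ ·)).Nonempty := Finset.card_pos.1 (by lia)
    -- Among the members containing `x`, one reaches furthest to the left and one furthest to the
    -- right; any third one is covered by these two.
    obtain ⟨L, hL, hleft⟩ := exists_forall_inter_Iic_subset hconn hne hxmem
    obtain ⟨R, hR, hright⟩ := exists_forall_inter_Ici_subset hconn hne hxmem
    obtain ⟨M, hM, hMLR⟩ : ∃ M ∈ s.filter (x ∈ ·), M ∉ ({L, R} : Finset (Set α)) :=
      Finset.exists_mem_notMem_of_card_lt_card (Finset.card_le_two.trans_lt hcard)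
    have hMs := (Finset.mem_filter.1 hM).1
    simp only [Finset.mem_insert, Finset.mem_singleton, not_or] at hMLR
    have hcover : M ⊆ ⋃₀ (s.erase M : Set (Set α)) := by
      intro y hy
      rcases le_total y x with hyx | hxy
      · exact ⟨L, by simp [(Finset.mem_filter.1 hL).1, Ne.symm hMLR.1], (hleft M hM ⟨hy, hyx⟩).1⟩
      · exact ⟨R, by simp [(Finset.mem_filter.1 hR).1, Ne.symm hMLR.2], (hright M hM ⟨hy, hxy⟩).1⟩
    obtain ⟨t, hts, hunion, ht⟩ := ih (s.erase M) (Finset.erase_ssubset hMs)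
      fun I hI => hs I (Finset.mem_of_mem_erase hI)
    refine ⟨t, hts.trans (Finset.erase_subset _ _), ?_, ht⟩
    rw [hunion, ← Finset.insert_erase hMs, Finset.coe_insert, sUnion_insert,
      Finset.erase_insert (Finset.notMem_erase M s), union_eq_right.2 hcover]

variable {X : Type*} [MeasurableSpace X] {μ : Measure X}

open scoped Classical in
lemma sum_measure_inter_le_of_card_le {t : Finset (Set X)} (ht : ∀ R ∈ t, MeasurableSet R)
    {N : ℕ} (hN : ∀ x, (t.filter (x ∈ ·)).card ≤ N) (E : Set X) :
    ∑ R ∈ t, μ (R ∩ E) ≤ N * μ E := by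
  calc ∑ R ∈ t, μ (R ∩ E)
      = ∑ R ∈ t, ∫⁻ x in E, R.indicator 1 x ∂μ := by
        refine Finset.sum_congr rfl fun R hR => ?_
        rw [lintegral_indicator_one (ht R hR), Measure.restrict_apply (ht R hR)]
    _ = ∫⁻ x in E, ∑ R ∈ t, R.indicator 1 x ∂μ :=
        (lintegral_finsetSum' _ fun R hR => (measurable_one.indicator (ht R hR)).aemeasurable).symm
    _ ≤ ∫⁻ _ in E, N ∂μ := by
        refine lintegral_mono fun x => ?_
        simp only [indicator_apply, Pi.one_apply, Finset.sum_boole]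
        exact_mod_cast hN x
    _ = N * μ E := by rw [setLIntegral_const]

lemma measure_sUnion_le_of_forall_finset {S : Set (Set X)} (hS : S.Countable) {c : ℝ≥0∞}
    (h : ∀ s : Finset (Set X), ↑s ⊆ S → μ (⋃₀ (s : Set (Set X))) ≤ c) : μ (⋃₀ S) ≤ c := by
  have := hS.to_subtype
  have hmono : Monotone fun s : Finset S => ⋃ R ∈ s, (R : Set X) :=
    fun s t hst => biUnion_subset_biUnion_left hst
  rw [sUnion_eq_iUnion, iUnion_eq_iUnion_finset, hmono.directed_le.measure_iUnion]
  refine iSup_le fun s => ?_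
  simpa [sUnion_eq_biUnion] using h (s.map (Function.Embedding.subtype _)) (by simp)

end BoundedOverlap

section LevelHalo

/-- The level halo of `E` with respect to a family `B`: the set `E` together with all members of `B`
in which the complement of `E` has relative measure less than `e`. For `e = 1 - t` this is, up to
adjoining `E`, the set where the maximal function of the indicator of `E` exceeds `t`. -/
def levelHalo {X : Type*} [MeasurableSpace X] (μ : Measure X) (B : Set (Set X)) (e : ℝ≥0∞)
    (E : Set X) : Set X :=
  E ∪ ⋃₀ {R ∈ B | μ (R \ E) < e * μ R}

/-- The family `B` satisfies a halo (Solyanik) estimate with constant `C` at the level `e`: passing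
to the level halo multiplies the measure of a measurable set by at most `C`. -/
def HaloBound {X : Type*} [MeasurableSpace X] (μ : Measure X) (B : Set (Set X)) (e C : ℝ≥0∞) :
    Prop :=
  ∀ E, MeasurableSet E → μ (levelHalo μ B e E) ≤ C * μ E

variable {X Y : Type*} [MeasurableSpace X] [MeasurableSpace Y] {μ : Measure X} {ν : Measure Y}
  {B : Set (Set X)} {B' : Set (Set Y)} {e e' C C' : ℝ≥0∞} {E : Set X}

lemma subset_levelHalo : E ⊆ levelHalo μ B e E := subset_union_left

lemma subset_levelHalo_of_lt {R : Set X} (hR : R ∈ B) (h : μ (R \ E) < e * μ R) :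
    R ⊆ levelHalo μ B e E :=
  (subset_sUnion_of_mem (show R ∈ {R ∈ B | μ (R \ E) < e * μ R} from ⟨hR, h⟩)).trans
    subset_union_right

lemma mem_levelHalo {x : X} :
    x ∈ levelHalo μ B e E ↔ x ∈ E ∨ ∃ R ∈ B, μ (R \ E) < e * μ R ∧ x ∈ R := by
  simp [levelHalo, and_assoc]

lemma measurableSet_levelHalo_of_isOpen [TopologicalSpace X] [OpensMeasurableSpace X]
    (hB : ∀ R ∈ B, IsOpen R) (hE : MeasurableSet E) : MeasurableSet (levelHalo μ B e E) :=
  hE.union (isOpen_sUnion fun R hR => hB R hR.1).measurableSet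

lemma measure_sdiff_le_mul_measure_inter {R : Set X} (hE : MeasurableSet E) (hR : μ R ≠ ∞)
    (he : e < 1) (h : μ (R \ E) < e * μ R) : μ (R \ E) ≤ e / (1 - e) * μ (R ∩ E) := by
  have hfin : e * μ (R \ E) ≠ ∞ :=
    ENNReal.mul_ne_top he.ne_top (measure_ne_top_of_subset sdiff_subset hR)
  rw [← measure_inter_add_sdiff R hE, mul_add] at h
  rw [mul_comm, ← mul_div_assoc, ENNReal.le_div_iff_mul_le (.inl (tsub_pos_of_lt he).ne')
    (.inl (ENNReal.sub_ne_top ENNReal.one_ne_top)), ENNReal.mul_sub fun _ _ => by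
      exact measure_ne_top_of_subset sdiff_subset hR, mul_one, tsub_le_iff_right,
    mul_comm _ e, mul_comm _ e]
  exact h.le

open scoped Classical in
lemma haloBound_of_exists_card_le (hcount : B.Countable) (hmeas : ∀ R ∈ B, MeasurableSet R)
    (hfin : ∀ R ∈ B, μ R ≠ ∞) {N : ℕ}
    (hN : ∀ s : Finset (Set X), ↑s ⊆ B →
      ∃ t ⊆ s, ⋃₀ (t : Set (Set X)) = ⋃₀ s ∧ ∀ x, (t.filter (x ∈ ·)).card ≤ N)
    (he : e < 1) : HaloBound μ B e (1 + N * (e / (1 - e))) := by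
  intro E hE
  have hfinite : ∀ s : Finset (Set X), ↑s ⊆ {R ∈ B | μ (R \ E) < e * μ R} →
      μ (⋃₀ s \ E) ≤ N * (e / (1 - e)) * μ E := by
    intro s hs
    obtain ⟨t, hts, hunion, hcard⟩ := hN s fun R hR => (hs hR).1
    calc μ (⋃₀ s \ E) = μ (⋃ R ∈ t, R \ E) := by
          simp only [← hunion, sUnion_eq_biUnion, iUnion_sdiff, Finset.mem_coe]
      _ ≤ ∑ R ∈ t, μ (R \ E) := measure_biUnion_finset_le _ _
      _ ≤ ∑ R ∈ t, e / (1 - e) * μ (R ∩ E) := Finset.sum_le_sum fun R hR =>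
          measure_sdiff_le_mul_measure_inter hE (hfin R (hs (hts hR)).1) he (hs (hts hR)).2
      _ ≤ e / (1 - e) * (N * μ E) := by
          rw [← Finset.mul_sum]
          gcongr
          exact sum_measure_inter_le_of_card_le (fun R hR => hmeas R (hs (hts hR)).1) hcard E
      _ = N * (e / (1 - e)) * μ E := by ring
  have hnew : μ (⋃₀ {R ∈ B | μ (R \ E) < e * μ R} \ E) ≤ N * (e / (1 - e)) * μ E := by
    rw [Set.sdiff_eq, ← Measure.restrict_apply' hE.compl]
    refine measure_sUnion_le_of_forall_finset (hcount.mono (sep_subset _ _)) fun s hs => ?_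
    rw [Measure.restrict_apply' hE.compl]
    exact hfinite s hs
  calc μ (levelHalo μ B e E)
      ≤ μ E + μ (⋃₀ {R ∈ B | μ (R \ E) < e * μ R} \ E) := by
        rw [levelHalo, ← union_sdiff_self]; exact measure_union_le _ _
    _ ≤ (1 + N * (e / (1 - e))) * μ E := by rw [add_mul, one_mul]; gcongr

lemma HaloBound.mono (hC : C ≤ C') (h : HaloBound μ B e C) : HaloBound μ B e C' :=
  fun E hE => (h E hE).trans (by gcongr)

lemma HaloBound.of_levelHalo_subset {B₁ B₂ : Set (Set X)}
    (hsub : ∀ E, levelHalo μ B₁ e E ⊆ levelHalo μ B₂ e E) (h : HaloBound μ B₂ e C) :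
    HaloBound μ B₁ e C :=
  fun E hE => (measure_mono (hsub E)).trans (h E hE)

lemma HaloBound.of_measurePreserving (f : X ≃ᵐ Y) (hf : MeasurePreserving f μ ν)
    (hB : B ⊆ (f ⁻¹' ·) '' B') (h : HaloBound ν B' e C) : HaloBound μ B e C := by
  intro E hE
  have hmeas : ∀ S : Set Y, μ (f ⁻¹' S) = ν S := fun S => hf.measure_preimage_equiv S
  have hEf : E = f ⁻¹' (f.symm ⁻¹' E) := by rw [← preimage_comp, f.symm_comp_self, preimage_id]
  have hsub : levelHalo μ B e E ⊆ f ⁻¹' levelHalo ν B' e (f.symm ⁻¹' E) := by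
    refine union_subset (hEf.subset.trans (preimage_mono subset_levelHalo)) (sUnion_subset ?_)
    rintro R ⟨hRB, hR⟩
    obtain ⟨R', hR', rfl⟩ := hB hRB
    rw [hEf, ← preimage_sdiff, hmeas, hmeas] at hR
    exact preimage_mono (subset_levelHalo_of_lt hR' hR)
  calc μ (levelHalo μ B e E) ≤ ν (levelHalo ν B' e (f.symm ⁻¹' E)) :=
        (measure_mono hsub).trans (hmeas _).le
    _ ≤ C * ν (f.symm ⁻¹' E) := h _ (f.symm.measurable hE)
    _ = C * μ E := by rw [← hmeas, ← hEf]

/-- The level halo taken separately in every vertical fibre of a set `F ⊆ X × Y`. -/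
def fiberLevelHalo (ν : Measure Y) (B' : Set (Set Y)) (e' : ℝ≥0∞) (F : Set (X × Y)) :
    Set (X × Y) :=
  {p | p.2 ∈ levelHalo ν B' e' (Prod.mk p.1 ⁻¹' F)}

lemma measurableSet_fiberLevelHalo [SFinite ν] (hcount : B'.Countable)
    (hmeas : ∀ R ∈ B', MeasurableSet R) {F : Set (X × Y)} (hF : MeasurableSet F) :
    MeasurableSet (fiberLevelHalo ν B' e' F) := by
  have hunion : fiberLevelHalo ν B' e' F =
      F ∪ ⋃ R ∈ B', {x | ν (R \ Prod.mk x ⁻¹' F) < e' * ν R} ×ˢ R := by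
    ext ⟨x, y⟩
    simp [fiberLevelHalo, mem_levelHalo, and_left_comm]
  rw [hunion]
  refine hF.union (.biUnion hcount fun R hR => .prod ?_ (hmeas R hR))
  refine measurableSet_lt ?_ measurable_const
  have hfiber : ∀ x, R \ Prod.mk x ⁻¹' F = Prod.mk x ⁻¹' ((univ ×ˢ R) \ F) := fun x => by
    simp [preimage_sdiff]
  simpa only [hfiber] using
    measurable_measure_prodMk_left ((MeasurableSet.univ.prod (hmeas R hR)).diff hF)

lemma measure_fiberLevelHalo_le [SFinite ν] (hcount : B'.Countable)
    (hmeas : ∀ R ∈ B', MeasurableSet R) (h : HaloBound ν B' e' C') {F : Set (X × Y)}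
    (hF : MeasurableSet F) :
    μ.prod ν (fiberLevelHalo ν B' e' F) ≤ C' * μ.prod ν F := by
  rw [Measure.prod_apply (measurableSet_fiberLevelHalo hcount hmeas hF), Measure.prod_apply hF,
    ← lintegral_const_mul _ (measurable_measure_prodMk_left hF)]
  exact lintegral_mono fun x => h _ (measurable_prodMk_left hF)

lemma mul_measure_sdiff_fiberLevelHalo_le [SFinite ν] {R : Set X} {R' : Set Y}
    (hRm : MeasurableSet R) (hR'm : MeasurableSet R') (hR' : R' ∈ B') {F : Set (X × Y)}
    (hF : MeasurableSet F) {y : Y} (hy : y ∈ R') :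
    e' * ν R' * μ (R \ (·, y) ⁻¹' fiberLevelHalo ν B' e' F) ≤ μ.prod ν (R ×ˢ R' \ F) := by
  have hrect := (hRm.prod hR'm).diff hF
  rw [Measure.prod_apply hrect]
  refine le_trans ?_ (mul_meas_ge_le_lintegral (measurable_measure_prodMk_left hrect) (e' * ν R'))
  gcongr
  rintro x ⟨hxR, hx⟩
  have hfiber : Prod.mk x ⁻¹' (R ×ˢ R' \ F) = R' \ Prod.mk x ⁻¹' F := by
    rw [preimage_sdiff, mk_preimage_prod_right hxR]
  change e' * ν R' ≤ ν (Prod.mk x ⁻¹' (R ×ˢ R' \ F))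
  rw [hfiber]
  exact not_lt.1 fun hlt => hx (subset_levelHalo_of_lt hR' hlt hy)

lemma levelHalo_prod_subset [SFinite ν] (hB : ∀ R ∈ B, MeasurableSet R)
    (hB' : ∀ R ∈ B', MeasurableSet R) {F : Set (X × Y)} (hF : MeasurableSet F) :
    levelHalo (μ.prod ν) (image2 (· ×ˢ ·) B B') (e * e') F ⊆
      Prod.swap ⁻¹' fiberLevelHalo μ B e (Prod.swap ⁻¹' fiberLevelHalo ν B' e' F) := by
  rintro ⟨x, y⟩ hxy
  rcases mem_levelHalo.1 hxy with hxy | ⟨_, ⟨R, hR, R', hR', rfl⟩, hlt, hx, hy⟩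
  · exact subset_levelHalo (subset_levelHalo hxy)
  refine subset_levelHalo_of_lt hR ?_ hx
  by_contra! hge
  refine hlt.not_ge ?_
  calc e * e' * μ.prod ν (R ×ˢ R') = e' * ν R' * (e * μ R) := by rw [Measure.prod_prod]; ring
    _ ≤ e' * ν R' * μ (R \ (·, y) ⁻¹' fiberLevelHalo ν B' e' F) := by gcongr; exact hge
    _ ≤ μ.prod ν (R ×ˢ R' \ F) :=
        mul_measure_sdiff_fiberLevelHalo_le (hB R hR) (hB' R' hR') hR' hF hy

lemma HaloBound.prod [SFinite μ] [SFinite ν] (hBc : B.Countable) (hB'c : B'.Countable)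
    (hB : ∀ R ∈ B, MeasurableSet R) (hB' : ∀ R ∈ B', MeasurableSet R)
    (h : HaloBound μ B e C) (h' : HaloBound ν B' e' C') :
    HaloBound (μ.prod ν) (image2 (· ×ˢ ·) B B') (e * e') (C * C') := by
  intro F hF
  have hvert := measurableSet_fiberLevelHalo (e' := e') (ν := ν) hB'c hB' hF
  have hhor := measurableSet_fiberLevelHalo (e' := e) (ν := μ) hBc hB (measurable_swap hvert)
  have hswap {S : Set (X × Y)} (hS : MeasurableSet S) : ν.prod μ (Prod.swap ⁻¹' S) = μ.prod ν S :=
    Measure.measurePreserving_swap.measure_preimage hS.nullMeasurableSet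
  calc μ.prod ν (levelHalo (μ.prod ν) (image2 (· ×ˢ ·) B B') (e * e') F)
      ≤ μ.prod ν (Prod.swap ⁻¹'
          fiberLevelHalo μ B e (Prod.swap ⁻¹' fiberLevelHalo ν B' e' F)) :=
        measure_mono (levelHalo_prod_subset hB hB' hF)
    _ = ν.prod μ (fiberLevelHalo μ B e (Prod.swap ⁻¹' fiberLevelHalo ν B' e' F)) :=
        Measure.measurePreserving_swap.measure_preimage hhor.nullMeasurableSet
    _ ≤ C * μ.prod ν (fiberLevelHalo ν B' e' F) := by
        rw [← hswap hvert]
        exact measure_fiberLevelHalo_le hBc hB h (measurable_swap hvert)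
    _ ≤ C * (C' * μ.prod ν F) := by
        gcongr
        exact measure_fiberLevelHalo_le hB'c hB' h' hF
    _ = C * C' * μ.prod ν F := (mul_assoc _ _ _).symm

end LevelHalo

section StrongBasis

/-- The open box in `ℝⁿ` with rational endpoints `p.1 i`, `p.2 i`. -/
def ratBox {n : ℕ} (p : (Fin n → ℚ) × (Fin n → ℚ)) : Set (Fin n → ℝ) :=
  univ.pi fun i => Ioo (p.1 i : ℝ) (p.2 i)

variable {n : ℕ}

lemma mem_ratBox {p : (Fin n → ℚ) × (Fin n → ℚ)} {x : Fin n → ℝ} :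
    x ∈ ratBox p ↔ ∀ i, (p.1 i : ℝ) < x i ∧ x i < p.2 i := by
  simp [ratBox]

lemma measurableSet_ratBox (p : (Fin n → ℚ) × (Fin n → ℚ)) : MeasurableSet (ratBox p) :=
  .univ_pi fun _ => measurableSet_Ioo

lemma haloBound_range_Ioo_ratCast {e : ℝ≥0∞} (he : e < 1) :
    HaloBound volume (range fun p : ℚ × ℚ => Ioo (p.1 : ℝ) p.2) e (1 + 2 * (e / (1 - e))) := by
  refine haloBound_of_exists_card_le (N := 2) (countable_range _) ?_ ?_ ?_ he
  · rintro _ ⟨p, rfl⟩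
    exact measurableSet_Ioo
  · rintro _ ⟨p, rfl⟩
    exact measure_Ioo_lt_top.ne
  · refine fun s hs => exists_subset_sUnion_eq_card_le_two s fun I hI => ?_
    obtain ⟨p, rfl⟩ := hs hI
    exact ordConnected_Ioo

lemma haloBound_one_of_subsingleton {X : Type*} [MeasurableSpace X] [Subsingleton X]
    {μ : Measure X} {B : Set (Set X)} : HaloBound μ B 1 1 := by
  refine fun E _ => (measure_mono ?_).trans_eq (one_mul _).symm
  refine union_subset subset_rfl (sUnion_subset ?_)
  rintro R ⟨-, hR⟩
  rcases E.eq_empty_or_nonempty with rfl | ⟨x, hx⟩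
  · simp at hR
  · exact fun y _ => Subsingleton.elim x y ▸ hx

lemma haloBound_range_ratBox {e : ℝ≥0∞} (he : e < 1) (n : ℕ) :
    HaloBound volume (range (ratBox (n := n))) (e ^ n) ((1 + 2 * (e / (1 - e))) ^ n) := by
  induction n with
  | zero => simpa only [pow_zero] using haloBound_one_of_subsingleton
  | succ n ih =>
    rw [pow_succ', pow_succ']
    refine HaloBound.of_measurePreserving (MeasurableEquiv.piFinSuccAbove (fun _ => ℝ) 0)
      (volume_preserving_piFinSuccAbove (fun _ => ℝ) 0) ?_
      ((haloBound_range_Ioo_ratCast he).prod (countable_range _) (countable_range _)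
        (forall_mem_range.2 fun _ => measurableSet_Ioo)
        (forall_mem_range.2 measurableSet_ratBox) ih)
    rintro _ ⟨p, rfl⟩
    refine ⟨_, ⟨_, ⟨(p.1 0, p.2 0), rfl⟩, _, ⟨(Fin.tail p.1, Fin.tail p.2), rfl⟩, rfl⟩, ?_⟩
    ext x
    simp [mem_ratBox, MeasurableEquiv.piFinSuccAbove, Fin.forall_fin_succ, Fin.tail]

lemma exists_ratBox_subset {a b x : Fin n → ℝ} (hx : x ∈ univ.pi fun i => Ioo (a i) (b i))
    {c e : ℝ≥0∞} (hc : c < e * volume (univ.pi fun i => Ioo (a i) (b i))) :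
    ∃ p, x ∈ ratBox p ∧ ratBox p ⊆ (univ.pi fun i => Ioo (a i) (b i)) ∧
      c < e * volume (ratBox p) := by
  let J := {p : (Fin n → ℚ) × (Fin n → ℚ) // ∀ i, a i < p.1 i ∧ (p.2 i : ℝ) < b i}
  have hdir : Directed (· ⊆ ·) fun p : J => ratBox p.1 := by
    refine fun p q => ⟨⟨(p.1.1 ⊓ q.1.1, p.1.2 ⊔ q.1.2), fun i => ?_⟩, ?_, ?_⟩
    · simp [p.2 i, q.2 i]
    all_goals exact fun y hy => mem_ratBox.2 fun i => by simp [mem_ratBox.1 hy i]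
  have hsub : ∀ p : J, ratBox p.1 ⊆ univ.pi fun i => Ioo (a i) (b i) := fun p =>
    pi_mono fun i _ => Ioo_subset_Ioo (p.2 i).1.le (p.2 i).2.le
  have hcover : ∀ y ∈ univ.pi fun i => Ioo (a i) (b i), ∃ p : J, y ∈ ratBox p.1 := by
    intro y hy
    choose a' ha' using fun i => exists_rat_btwn (hy i trivial).1
    choose b' hb' using fun i => exists_rat_btwn (hy i trivial).2
    exact ⟨⟨(a', b'), fun i => ⟨(ha' i).1, (hb' i).2⟩⟩,
      mem_ratBox.2 fun i => ⟨(ha' i).2, (hb' i).1⟩⟩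
  have hunion : (univ.pi fun i => Ioo (a i) (b i)) = ⋃ p : J, ratBox p.1 :=
    subset_antisymm (fun y hy => mem_iUnion.2 (hcover y hy)) (iUnion_subset hsub)
  rw [hunion, hdir.measure_iUnion, ENNReal.mul_iSup] at hc
  obtain ⟨p, hp⟩ := lt_iSup_iff.1 hc
  obtain ⟨q, hxq⟩ := hcover x hx
  obtain ⟨r, hpr, hqr⟩ := hdir p q
  exact ⟨r.1, hqr hxq, hsub r, hp.trans_le (by gcongr)⟩

lemma levelHalo_strongBasis_subset (e : ℝ≥0∞) (E : Set (Fin n → ℝ)) :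
    levelHalo volume (strongBasis n) e E ⊆ levelHalo volume (range ratBox) e E := by
  refine union_subset subset_levelHalo (sUnion_subset ?_)
  rintro _ ⟨⟨a, b, -, rfl⟩, hlt⟩ x hx
  obtain ⟨p, hxp, hsub, hp⟩ := exists_ratBox_subset hx hlt
  exact subset_levelHalo_of_lt (mem_range_self p)
    ((measure_mono (sdiff_subset_sdiff_left hsub)).trans_lt hp) hxp

lemma haloBound_strongBasis_pow {e : ℝ≥0∞} (he : e < 1) (n : ℕ) :
    HaloBound volume (strongBasis n) (e ^ n) ((1 + 2 * (e / (1 - e))) ^ n) :=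
  (haloBound_range_ratBox he n).of_levelHalo_subset (levelHalo_strongBasis_subset _)

lemma one_add_pow_le_one_add_mul {R : Type*} [CommSemiring R] [PartialOrder R] [IsOrderedRing R]
    {x : R} (hx : 0 ≤ x) (n : ℕ) : (1 + x) ^ n ≤ 1 + n * x * (1 + x) ^ n := by
  induction n with
  | zero => simp
  | succ n ih =>
    calc (1 + x) ^ (n + 1) = (1 + x) ^ n + x * (1 + x) ^ n := by ring
      _ ≤ 1 + n * x * (1 + x) ^ n + x * (1 + x) ^ n := by gcongr
      _ = 1 + (n + 1) * x * (1 + x) ^ n := by ring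
      _ ≤ 1 + (n + 1 : ℕ) * x * (1 + x) ^ (n + 1) := by
        rw [Nat.cast_succ]
        gcongr
        · exact mul_nonneg (add_nonneg n.cast_nonneg zero_le_one) hx
        · exact le_add_of_nonneg_right hx
        · exact n.le_succ

lemma div_one_sub_le_two_mul {e : ℝ≥0∞} (he : e ≤ 2⁻¹) : e / (1 - e) ≤ 2 * e := by
  refine ENNReal.div_le_of_le_mul ?_
  have hhalf : (2⁻¹ : ℝ≥0∞) ≤ 1 - e :=
    ENNReal.le_sub_of_add_le_right (ne_top_of_le_ne_top (by simp) he)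
      ((add_le_add_right he _).trans_eq ENNReal.inv_two_add_inv_two)
  calc e = 2 * e * 2⁻¹ := by
        rw [mul_right_comm, ENNReal.mul_inv_cancel two_ne_zero ENNReal.ofNat_ne_top, one_mul]
    _ ≤ 2 * e * (1 - e) := by gcongr

lemma haloBound_strongBasis_pow_of_le {e : ℝ≥0∞} (he : e ≤ 2⁻¹) (n : ℕ) :
    HaloBound volume (strongBasis n) (e ^ n) (1 + n * 4 * 3 ^ n * e) := by
  have hlt : e < 1 := he.trans_lt (ENNReal.inv_lt_one.2 ENNReal.one_lt_two)
  refine (haloBound_strongBasis_pow hlt n).mono ?_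
  calc (1 + 2 * (e / (1 - e))) ^ n ≤ (1 + 4 * e) ^ n := by
        rw [show 4 * e = 2 * (2 * e) by ring]
        gcongr
        exact div_one_sub_le_two_mul he
    _ ≤ 1 + n * (4 * e) * (1 + 4 * e) ^ n := one_add_pow_le_one_add_mul zero_le n
    _ ≤ 1 + n * (4 * e) * 3 ^ n := by
        gcongr
        calc 1 + 4 * e ≤ 1 + 4 * 2⁻¹ := by gcongr
          _ = 3 := by
            rw [show (4 : ℝ≥0∞) = 2 * 2 by norm_num, mul_assoc,
              ENNReal.mul_inv_cancel two_ne_zero ENNReal.ofNat_ne_top]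
            norm_num
    _ = 1 + n * 4 * 3 ^ n * e := by ring

lemma haloBound_strongBasis (hn : n ≠ 0) {η : ℝ≥0} (hη : η ≤ 2⁻¹ ^ n) :
    HaloBound volume (strongBasis n) η
      ((1 + n * 4 * 3 ^ n * η ^ (1 / (n : ℝ)) : ℝ≥0) : ℝ≥0∞) := by
  have he : η ^ (1 / (n : ℝ)) ≤ 2⁻¹ := by
    rw [one_div]
    exact (NNReal.rpow_inv_le_iff (by positivity)).2 (by simpa using hη)
  have hpow : (η ^ (1 / (n : ℝ))) ^ n = η := by
    rw [one_div, NNReal.rpow_inv_natCast_pow _ hn]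
  have h := haloBound_strongBasis_pow_of_le (e := (η ^ (1 / (n : ℝ)) : ℝ≥0))
    (by simpa using ENNReal.coe_le_coe.2 he) n
  rw [← ENNReal.coe_pow, hpow] at h
  exact_mod_cast h

end StrongBasis

section Growth

open AffineMap Filter Metric
open scoped Pointwise Topology

lemma abs_measureReal_sdiff_sub_le {X : Type*} [MeasurableSpace X] {μ : Measure X} {s t : Set X}
    (hst : s ⊆ t) (hs : MeasurableSet s) (ht : μ t ≠ ∞) (E : Set X) :
    |μ.real (t \ E) - μ.real (s \ E)| ≤ |μ.real t - μ.real s| := by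
  have hsdiff : μ.real (t \ s) = μ.real t - μ.real s :=
    measureReal_sdiff hst hs ht
  have hmono : μ.real (s \ E) ≤ μ.real (t \ E) :=
    measureReal_mono (sdiff_subset_sdiff_left hst) (measure_ne_top_of_subset sdiff_subset ht)
  have hle : μ.real (t \ E) ≤ μ.real (s \ E) + μ.real (t \ s) := by
    refine (measureReal_mono (fun x hx => ?_) (measure_ne_top_of_subset
      (union_subset (sdiff_subset.trans hst) sdiff_subset) ht)).trans (measureReal_union_le _ _)
    by_cases hxs : x ∈ s
    exacts [.inl ⟨hxs, hx.2⟩, .inr ⟨hx.1, hxs⟩]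
  rw [abs_of_nonneg (sub_nonneg.2 hmono), ← hsdiff, abs_of_nonneg measureReal_nonneg]
  linarith

lemma continuousOn_measureReal_sdiff {X : Type*} [MeasurableSpace X] {μ : Measure X}
    {Q : ℝ → Set X} {S : Set ℝ} (hmono : MonotoneOn Q S) (hmeas : ∀ s ∈ S, MeasurableSet (Q s))
    (hfin : ∀ s ∈ S, μ (Q s) ≠ ∞) (hcont : ContinuousOn (fun s => μ.real (Q s)) S) (E : Set X) :
    ContinuousOn (fun s => μ.real (Q s \ E)) S := by
  intro s hs
  refine tendsto_iff_dist_tendsto_zero.2 (squeeze_zero' (.of_forall fun _ => dist_nonneg) ?_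
    (tendsto_iff_dist_tendsto_zero.1 (hcont s hs)))
  filter_upwards [self_mem_nhdsWithin] with t ht
  rcases le_total s t with hst | hts
  · exact abs_measureReal_sdiff_sub_le (hmono hs ht hst) (hmeas s hs) (hfin t ht) E
  · rw [dist_comm, dist_comm (μ.real (Q t))]
    exact abs_measureReal_sdiff_sub_le (hmono ht hs hts) (hmeas t ht) (hfin s hs) E

lemma exists_measure_sdiff_eq_mul {X : Type*} [MeasurableSpace X] {μ : Measure X}
    {Q : ℝ → Set X} {a b : ℝ} (hab : a ≤ b) (hmono : MonotoneOn Q (Icc a b))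
    (hmeas : ∀ s ∈ Icc a b, MeasurableSet (Q s)) (hfin : μ (Q b) ≠ ∞)
    (hcont : ContinuousOn (fun s => μ.real (Q s)) (Icc a b)) {E : Set X} {δ : ℝ≥0}
    (ha : μ (Q a \ E) ≤ δ * μ (Q a)) (hb : δ * μ (Q b) ≤ μ (Q b \ E)) :
    ∃ s ∈ Icc a b, μ (Q s \ E) = δ * μ (Q s) := by
  have hfin' : ∀ s ∈ Icc a b, μ (Q s) ≠ ∞ := fun s hs =>
    measure_ne_top_of_subset (hmono hs (right_mem_Icc.2 hab) hs.2) hfin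
  have hfinE : ∀ s ∈ Icc a b, μ (Q s \ E) ≠ ∞ := fun s hs =>
    measure_ne_top_of_subset sdiff_subset (hfin' s hs)
  have hfinδ : ∀ s ∈ Icc a b, δ * μ (Q s) ≠ ∞ := fun s hs =>
    ENNReal.mul_ne_top ENNReal.coe_ne_top (hfin' s hs)
  have hcontδ : ContinuousOn (fun s => (δ * μ (Q s)).toReal) (Icc a b) := by
    simpa only [ENNReal.toReal_mul, Measure.real] using hcont.const_mul (δ : ℝ≥0∞).toReal
  have ha' := left_mem_Icc.2 hab
  have hb' := right_mem_Icc.2 hab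
  obtain ⟨s, hs, heq⟩ := isPreconnected_Icc.intermediate_value₂ ha' hb'
    (continuousOn_measureReal_sdiff hmono hmeas hfin' hcont E) hcontδ
    ((ENNReal.toReal_le_toReal (hfinE a ha') (hfinδ a ha')).2 ha)
    ((ENNReal.toReal_le_toReal (hfinδ b hb') (hfinE b hb')).2 hb)
  exact ⟨s, hs, (ENNReal.toReal_eq_toReal_iff' (hfinE s hs) (hfinδ s hs)).1 heq⟩

lemma measure_sdiff_lt_of_lt_measure_inter {X : Type*} [MeasurableSpace X] {μ : Measure X}
    {Q E : Set X} (hE : MeasurableSet E) (hQ : μ Q ≠ ∞) {t e : ℝ≥0∞} (hte : 1 ≤ t + e)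
    (h : t * μ Q < μ (Q ∩ E)) : μ (Q \ E) < e * μ Q := by
  by_contra! hle
  refine (ENNReal.add_lt_add_of_lt_of_le ?_ h hle).not_ge ?_
  · exact ne_top_of_le_ne_top (measure_ne_top_of_subset sdiff_subset hQ) hle
  · rw [measure_inter_add_sdiff Q hE, ← add_mul]
    exact le_mul_of_one_le_left zero_le hte

variable {V : Type*} [NormedAddCommGroup V] [NormedSpace ℝ V] {R : Set V}

lemma image_homothety_subset_image_homothety (hR : Convex ℝ R) {x : V} (hx : x ∈ R) {s t : ℝ}
    (hs : 0 ≤ s) (hst : s ≤ t) : homothety x s '' R ⊆ homothety x t '' R := by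
  rcases hst.eq_or_lt with rfl | hlt
  · rfl
  have ht : 0 < t := hs.trans_lt hlt
  rintro _ ⟨y, hy, rfl⟩
  refine ⟨homothety x (s / t) y, ?_, by rw [← homothety_mul_apply, mul_div_cancel₀ _ ht.ne']⟩
  rw [homothety_eq_lineMap]
  exact hR.lineMap_mem hx hy ⟨by positivity, (div_le_one ht).2 hst⟩

lemma image_homothety_subset_of_inter_nonempty (hR : Convex ℝ R) {x y : V} {s t : ℝ} (hs : 0 ≤ s)
    (ht : 0 < t) (hst : s ≤ 2 * t) (hne : (homothety x s '' R ∩ homothety y t '' R).Nonempty) :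
    homothety x s '' R ⊆ homothety y t '' (R + (2 : ℝ) • (R - R)) := by
  obtain ⟨_, ⟨b, hb, rfl⟩, c, hc, hbc⟩ := hne
  rintro _ ⟨a, ha, rfl⟩
  have hmid : lineMap b a (s / (2 * t)) ∈ R :=
    hR.lineMap_mem hb ha ⟨by positivity, (div_le_one (by positivity)).2 hst⟩
  refine ⟨c + (2 : ℝ) • (lineMap b a (s / (2 * t)) - b),
    add_mem_add hc (smul_mem_smul_set (sub_mem_sub hmid hb)), ?_⟩
  simp only [homothety_apply, lineMap_apply, vsub_eq_sub, vadd_eq_add, add_sub_cancel_right]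
    at hbc ⊢
  have hcoef : t * (2 * (s / (2 * t))) = s := by field_simp
  calc t • (c + (2 : ℝ) • (s / (2 * t)) • (a - b) - y) + y
      = (t • (c - y) + y) + (t * (2 * (s / (2 * t)))) • (a - b) := by module
    _ = s • (a - x) + x := by rw [hbc, hcoef]; module

variable [FiniteDimensional ℝ V] [MeasurableSpace V] [BorelSpace V] {μ : Measure V}
  [μ.IsAddHaarMeasure] {E : Set V}

lemma measure_image_homothety_ne_top (hR : μ R ≠ ∞) (x : V) (s : ℝ) :
    μ (homothety x s '' R) ≠ ∞ := by
  rw [Measure.addHaar_image_homothety]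
  exact ENNReal.mul_ne_top ENNReal.ofReal_ne_top hR

lemma ae_eventually_measure_image_homothety_sdiff_lt (hE : MeasurableSet E)
    (hR : MeasurableSet R) (hR0 : μ R ≠ 0) (hRtop : μ R ≠ ∞) {δ : ℝ≥0∞} (hδ : δ ≠ 0) :
    ∀ᵐ x ∂μ.restrict E, ∀ᶠ s in 𝓝[>] (0 : ℝ),
      μ (homothety x s '' R \ E) < δ * μ (homothety x s '' R) := by
  filter_upwards [Besicovitch.ae_tendsto_measure_inter_div μ E] with x hx
  have hhom : ∀ s : ℝ, {x} + s • ({-x} + R) = homothety x s '' R := fun s => by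
    simp only [singleton_add, ← image_smul, image_image, coe_homothety, vsub_eq_sub, vadd_eq_add,
      add_comm x, neg_add_eq_sub]
  have hlim := Measure.tendsto_addHaar_inter_smul_one_of_density_one μ E x hx ({-x} + R)
    (by simpa using measurable_const_add x hR) (by simpa using hR0) (by simpa using hRtop)
  simp only [hhom] at hlim
  filter_upwards [hlim.eventually (lt_mem_nhds (ENNReal.sub_lt_self ENNReal.one_ne_top
    one_ne_zero hδ))] with s hs
  refine measure_sdiff_lt_of_lt_measure_inter hE (measure_image_homothety_ne_top hRtop x s)
    le_tsub_add ?_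
  rw [inter_comm]
  exact ENNReal.mul_lt_of_lt_div hs

lemma exists_measure_image_homothety_sdiff_eq (hR : Convex ℝ R) (hRo : IsOpen R)
    (hRtop : μ R ≠ ∞) {x : V} (hx : x ∈ R) {δ : ℝ≥0} (hδ : δ * μ R ≤ μ (R \ E))
    (hev : ∀ᶠ s in 𝓝[>] (0 : ℝ), μ (homothety x s '' R \ E) < δ * μ (homothety x s '' R)) :
    ∃ s ∈ Ioc (0 : ℝ) 1, μ (homothety x s '' R \ E) = δ * μ (homothety x s '' R) := by
  obtain ⟨a, ha, ha0, ha1⟩ := (hev.and (Ioo_mem_nhdsGT one_pos)).exists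
  have hone : homothety x (1 : ℝ) '' R = R := by rw [homothety_one, coe_id, image_id]
  have hcont : Continuous fun s : ℝ => μ.real (homothety x s '' R) := by
    simp only [Measure.real, Measure.addHaar_image_homothety, ENNReal.toReal_mul,
      ENNReal.toReal_ofReal (abs_nonneg _)]
    fun_prop
  obtain ⟨s, hs, heq⟩ := exists_measure_sdiff_eq_mul (Q := fun s : ℝ => homothety x s '' R) ha1.le
    (fun s hs t _ hst => image_homothety_subset_image_homothety hR hx (ha0.le.trans hs.1) hst)
    (fun s hs => (homothety_isOpenMap x s (ha0.trans_le hs.1).ne' _ hRo).measurableSet)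
    (by rwa [hone]) hcont.continuousOn ha.le (by rwa [hone])
  exact ⟨s, ⟨ha0.trans_le hs.1, hs.2⟩, heq⟩

lemma exists_disjoint_image_homothety_measure_le (hRc : Convex ℝ R) (hRo : IsOpen R)
    (hRne : R.Nonempty) {K : ℝ≥0∞} (hK : μ (R + (2 : ℝ) • (R - R)) ≤ K * μ R) {G : Set V}
    (hG : G ⊆ R) {s : V → ℝ} (hs : ∀ x ∈ G, s x ∈ Ioc 0 1) :
    ∃ u ⊆ G, u.Countable ∧ u.PairwiseDisjoint (fun x => homothety x (s x) '' R) ∧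
      μ G ≤ K * ∑' y : u, μ (homothety (y : V) (s y) '' R) := by
  obtain ⟨u, huG, hdisj, hcov⟩ := Vitali.exists_disjoint_subfamily_covering_enlargement
    (fun x => homothety x (s x) '' R) G s 2 one_lt_two (fun x hx => (hs x hx).1.le) 1
    (fun x hx => (hs x hx).2) fun x _ => hRne.image _
  have hucount : u.Countable := hdisj.countable_of_isOpen
    (fun x hx => homothety_isOpenMap x _ (hs x (huG hx)).1.ne' _ hRo) fun x _ => hRne.image _
  have hGcov : G ⊆ ⋃ y ∈ u, homothety y (s y) '' (R + (2 : ℝ) • (R - R)) := by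
    intro x hx
    obtain ⟨y, hy, hxy, hsxy⟩ := hcov x hx
    exact mem_iUnion₂.2 ⟨y, hy, image_homothety_subset_of_inter_nonempty hRc (hs x hx).1.le
      (hs y (huG hy)).1 hsxy hxy ⟨x, hG hx, homothety_apply_same x _⟩⟩
  refine ⟨u, huG, hucount, hdisj, ?_⟩
  calc μ G ≤ ∑' y : u, μ (homothety (y : V) (s y) '' (R + (2 : ℝ) • (R - R))) :=
        (measure_mono hGcov).trans (measure_biUnion_le μ hucount _)
    _ ≤ ∑' y : u, K * μ (homothety (y : V) (s y) '' R) := by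
        gcongr with y
        simp only [Measure.addHaar_image_homothety, mul_left_comm K]
        gcongr
    _ = K * ∑' y : u, μ (homothety (y : V) (s y) '' R) := ENNReal.tsum_mul_left

lemma measure_inter_le_measure_levelHalo_sdiff {B : Set (Set V)} (hE : MeasurableSet E)
    (hRc : Convex ℝ R) (hRo : IsOpen R) (hRne : R.Nonempty) (hRtop : μ R ≠ ∞)
    (hB : ∀ x, ∀ s : ℝ, 0 < s → homothety x s '' R ∈ B) {K : ℝ≥0∞}
    (hK : μ (R + (2 : ℝ) • (R - R)) ≤ K * μ R) {δ : ℝ≥0} (hδ : δ ≠ 0) {e : ℝ≥0∞} (hδe : δ < e)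
    (h : δ * μ R ≤ μ (R \ E)) :
    δ * μ (R ∩ E) ≤ K * μ ((R ∩ levelHalo μ B e E) \ E) := by
  set G : Set V := {x ∈ R | ∀ᶠ s in 𝓝[>] (0 : ℝ),
    μ (homothety x s '' R \ E) < δ * μ (homothety x s '' R)}
  have hae : (R ∩ E : Set V) ≤ᵐ[μ] G := by
    have hR0 := (hRo.measure_pos μ hRne).ne'
    filter_upwards [(ae_restrict_iff' hE).1 (ae_eventually_measure_image_homothety_sdiff_lt hE
      hRo.measurableSet hR0 hRtop (ENNReal.coe_ne_zero.2 hδ))] with x hx hxE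
    exact ⟨hxE.1, hx hxE.2⟩
  choose! s hs hsδ using fun x (hx : x ∈ G) =>
    exists_measure_image_homothety_sdiff_eq hRc hRo hRtop hx.1 h hx.2
  set Q : V → Set V := fun x => homothety x (s x) '' R
  have hQo : ∀ x ∈ G, IsOpen (Q x) := fun x hx => homothety_isOpenMap x _ (hs x hx).1.ne' _ hRo
  have hQR : ∀ x ∈ G, Q x ⊆ R := fun x hx => by
    simpa only [homothety_one, coe_id, image_id] using
      image_homothety_subset_image_homothety hRc hx.1 (hs x hx).1.le (hs x hx).2
  have hQhalo : ∀ x ∈ G, Q x ⊆ levelHalo μ B e E := fun x hx => by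
    refine subset_levelHalo_of_lt (hB x _ (hs x hx).1) ?_
    rw [hsδ x hx, ENNReal.mul_lt_mul_iff_left ((hQo x hx).measure_pos μ (hRne.image _)).ne'
      (measure_image_homothety_ne_top hRtop x _)]
    exact hδe
  obtain ⟨u, huG, hucount, hdisj, hle⟩ :=
    exists_disjoint_image_homothety_measure_le hRc hRo hRne hK (sep_subset _ _) hs
  calc δ * μ (R ∩ E) ≤ δ * (K * ∑' y : u, μ (Q y)) := by
        gcongr
        exact (measure_mono_ae hae).trans hle
    _ = K * ∑' y : u, μ (Q y \ E) := by
        rw [mul_left_comm, ← ENNReal.tsum_mul_left]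
        congr! 3 with y
        exact (hsδ y (huG y.2)).symm
    _ = K * μ (⋃ y ∈ u, Q y \ E) := by
        rw [measure_biUnion hucount (fun x hx y hy hxy =>
          (hdisj hx hy hxy).mono sdiff_subset sdiff_subset)
          fun y hy => (hQo y (huG hy)).measurableSet.diff hE]
    _ ≤ K * μ ((R ∩ levelHalo μ B e E) \ E) := by
        gcongr
        exact iUnion₂_subset fun y hy =>
          sdiff_subset_sdiff_left (subset_inter (hQR y (huG hy)) (hQhalo y (huG hy)))

end Growth

section HaloFunction

open AffineMap
open scoped Pointwise

/-- `B` is a homothecy basis: nonempty open convex sets of finite measure, invariant under all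
homotheties of positive ratio. The set `R + 2 (R - R)` contains every homothetic copy of `R` of
ratio at most `2` that meets `R`; the constant `K` bounds its measure relative to that of `R`, which
is what Vitali coverings by homothetic copies require. -/
structure IsHomothecyBasis {n : ℕ} (B : Set (Set (Fin n → ℝ))) (K : ℝ≥0) : Prop where
  isOpen : ∀ R ∈ B, IsOpen R
  nonempty : ∀ R ∈ B, R.Nonempty
  convex : ∀ R ∈ B, Convex ℝ R
  volume_ne_top : ∀ R ∈ B, volume R ≠ ∞
  image_homothety_mem : ∀ R ∈ B, ∀ x, ∀ s : ℝ, 0 < s → homothety x s '' R ∈ B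
  volume_add_smul_sub_le : ∀ R ∈ B, volume (R + (2 : ℝ) • (R - R)) ≤ K * volume R

variable {n : ℕ} {B : Set (Set (Fin n → ℝ))} {K : ℝ≥0} {E : Set (Fin n → ℝ)}

lemma IsHomothecyBasis.volume_ne_zero (hB : IsHomothecyBasis B K) {R : Set (Fin n → ℝ)}
    (hR : R ∈ B) : volume R ≠ 0 :=
  ((hB.isOpen R hR).measure_pos volume (hB.nonempty R hR)).ne'

lemma IsHomothecyBasis.one_le (hB : IsHomothecyBasis B K) (hne : B.Nonempty) : 1 ≤ K := by
  obtain ⟨R, hR⟩ := hne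
  have hsub : R ⊆ R + (2 : ℝ) • (R - R) := fun x hx =>
    ⟨x, hx, (2 : ℝ) • (x - x), smul_mem_smul_set (sub_mem_sub hx hx), by simp⟩
  rw [← ENNReal.one_le_coe_iff,
    ← ENNReal.mul_le_mul_iff_left (hB.volume_ne_zero hR) (hB.volume_ne_top R hR), one_mul]
  exact (measure_mono hsub).trans (hB.volume_add_smul_sub_le R hR)

lemma image_homothety_univ_pi_Ioo (a b x : Fin n → ℝ) {s : ℝ} (hs : 0 < s) :
    homothety x s '' univ.pi (fun i => Ioo (a i) (b i)) =
      univ.pi fun i => Ioo (s * (a i - x i) + x i) (s * (b i - x i) + x i) := by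
  ext y
  simp only [mem_image, mem_univ_pi, mem_Ioo, homothety_apply, vsub_eq_sub, vadd_eq_add]
  constructor
  · rintro ⟨z, hz, rfl⟩ i
    simpa [hs] using hz i
  · refine fun hy => ⟨s⁻¹ • (y - x) + x, fun i => ?_, by simp [hs.ne']⟩
    simp only [Pi.add_apply, Pi.smul_apply, Pi.sub_apply, smul_eq_mul, ← sub_lt_iff_lt_add,
      ← lt_sub_iff_add_lt, lt_inv_mul_iff₀ hs, inv_mul_lt_iff₀ hs]
    exact ⟨lt_sub_iff_add_lt.2 (hy i).1, sub_lt_iff_lt_add.2 (hy i).2⟩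

lemma univ_pi_Ioo_add_smul_sub_subset (a b : Fin n → ℝ) :
    univ.pi (fun i => Ioo (a i) (b i)) + (2 : ℝ) •
        (univ.pi (fun i => Ioo (a i) (b i)) - univ.pi fun i => Ioo (a i) (b i)) ⊆
      univ.pi fun i => Ioo (a i - 2 * (b i - a i)) (b i + 2 * (b i - a i)) := by
  rintro _ ⟨x, hx, _, ⟨_, ⟨y, hy, z, hz, rfl⟩, rfl⟩, rfl⟩ i -
  have := hx i trivial
  have := hy i trivial
  have := hz i trivial
  simp only [mem_Ioo, Pi.add_apply, Pi.smul_apply, Pi.sub_apply, smul_eq_mul] at *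
  constructor <;> linarith

lemma isHomothecyBasis_strongBasis (n : ℕ) : IsHomothecyBasis (strongBasis n) (5 ^ n) where
  isOpen := by
    rintro _ ⟨a, b, -, rfl⟩
    exact isOpen_set_pi finite_univ fun _ _ => isOpen_Ioo
  nonempty := by
    rintro _ ⟨a, b, hab, rfl⟩
    exact univ_pi_nonempty_iff.2 fun i => nonempty_Ioo.2 (hab i)
  convex := by
    rintro _ ⟨a, b, -, rfl⟩
    exact convex_pi fun _ _ => convex_Ioo _ _
  volume_ne_top := by
    rintro _ ⟨a, b, -, rfl⟩
    rw [Real.volume_pi_Ioo]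
    exact (ENNReal.prod_lt_top fun _ _ => ENNReal.ofReal_lt_top).ne
  image_homothety_mem := by
    rintro _ ⟨a, b, hab, rfl⟩ x s hs
    exact ⟨_, _, fun i => by have := hab i; gcongr, image_homothety_univ_pi_Ioo a b x hs⟩
  volume_add_smul_sub_le := by
    rintro _ ⟨a, b, -, rfl⟩
    refine (measure_mono (univ_pi_Ioo_add_smul_sub_subset a b)).trans_eq ?_
    have hside (i : Fin n) : ENNReal.ofReal (b i + 2 * (b i - a i) - (a i - 2 * (b i - a i))) =
        5 * ENNReal.ofReal (b i - a i) := by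
      rw [← ENNReal.ofReal_ofNat 5, ← ENNReal.ofReal_mul (by norm_num)]
      ring_nf
    simp only [Real.volume_pi_Ioo, hside, Finset.prod_mul_distrib]
    simp

lemma mem_haloSet_iff (hB0 : ∀ R ∈ B, volume R ≠ 0) (hBtop : ∀ R ∈ B, volume R ≠ ∞) {t : ℝ}
    (hE : MeasurableSet E) {x : Fin n → ℝ} :
    x ∈ haloSet B t E ↔
      ∃ R ∈ B, x ∈ R ∧ ENNReal.ofReal t * volume R < volume (R ∩ E) := by
  have hint (R : Set (Fin n → ℝ)) :
      ∫⁻ y in R, ‖E.indicator (fun _ => (1 : ℝ)) y‖ₑ = volume (R ∩ E) := by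
    simp only [enorm_indicator_eq_indicator_enorm, enorm_one]
    rw [inter_comm, ← Measure.restrict_apply hE]
    exact lintegral_indicator_one hE
  simp only [haloSet, maximalOperator, mem_ofPred_eq, lt_iSup_iff, hint, exists_prop, and_assoc]
  refine exists_congr fun R => and_congr_right fun hR => and_congr_right fun _ => ?_
  exact ENNReal.lt_div_iff_mul_lt (.inl (hB0 R hR)) (.inl (hBtop R hR))

lemma IsHomothecyBasis.mem_haloSet (hB : IsHomothecyBasis B K) {t : ℝ} (hE : MeasurableSet E)
    {x : Fin n → ℝ} :
    x ∈ haloSet B t E ↔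
      ∃ R ∈ B, x ∈ R ∧ ENNReal.ofReal t * volume R < volume (R ∩ E) :=
  mem_haloSet_iff (fun _ hR => hB.volume_ne_zero hR) hB.volume_ne_top hE

lemma IsHomothecyBasis.haloSet_subset_levelHalo (hB : IsHomothecyBasis B K)
    (hE : MeasurableSet E) {t : ℝ} {e : ℝ≥0∞} (hte : 1 ≤ ENNReal.ofReal t + e) :
    haloSet B t E ⊆ levelHalo volume B e E := by
  intro x hx
  obtain ⟨R, hR, hxR, hlt⟩ := (hB.mem_haloSet hE).1 hx
  exact subset_levelHalo_of_lt hR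
    (measure_sdiff_lt_of_lt_measure_inter hE (hB.volume_ne_top R hR) hte hlt) hxR

lemma IsHomothecyBasis.mul_volume_lt_of_not_subset_levelHalo (hB : IsHomothecyBasis B K)
    (hE : MeasurableSet E) {R : Set (Fin n → ℝ)} (hR : R ∈ B) {δ : ℝ≥0} (hδ : δ ≠ 0) {e : ℝ≥0∞}
    (hδe : δ < e) (hsub : ¬ R ⊆ levelHalo volume B e E) {t : ℝ≥0∞}
    (ht : t * volume R < volume (R ∩ E)) :
    (K + δ) * t * volume R < K * volume (R ∩ levelHalo volume B e E) := by
  have hfull : δ * volume R ≤ volume (R \ E) := by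
    by_contra! hlt
    exact hsub (subset_levelHalo_of_lt hR (hlt.trans_le (by gcongr)))
  have hgrowth : δ * volume (R ∩ E) ≤ K * volume ((R ∩ levelHalo volume B e E) \ E) :=
    measure_inter_le_measure_levelHalo_sdiff hE (hB.convex R hR) (hB.isOpen R hR)
      (hB.nonempty R hR) (hB.volume_ne_top R hR) (hB.image_homothety_mem R hR)
      (hB.volume_add_smul_sub_le R hR) hδ hδe hfull
  have hinter : R ∩ levelHalo volume B e E ∩ E = R ∩ E := by
    rw [inter_assoc, inter_eq_right.2 subset_levelHalo]
  calc (K + δ) * t * volume R = (K + δ) * (t * volume R) := mul_assoc _ _ _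
    _ < (K + δ) * volume (R ∩ E) := ENNReal.mul_lt_mul_right (by simp [hδ]) (by simp) ht
    _ = K * volume (R ∩ E) + δ * volume (R ∩ E) := add_mul _ _ _
    _ ≤ K * volume (R ∩ E) + K * volume ((R ∩ levelHalo volume B e E) \ E) := by gcongr
    _ = K * volume (R ∩ levelHalo volume B e E) := by
        rw [← mul_add, ← hinter, measure_inter_add_sdiff _ hE]

lemma IsHomothecyBasis.haloSet_subset_haloSet_levelHalo (hB : IsHomothecyBasis B K)
    (hE : MeasurableSet E) {δ : ℝ≥0} (hδ : δ ≠ 0) {e : ℝ≥0∞} (hδe : δ < e) {s t : ℝ}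
    (hs : s < 1) (hst : K * s ≤ (K + δ) * t) :
    haloSet B t E ⊆ haloSet B s (levelHalo volume B e E) := by
  intro x hx
  obtain ⟨R, hR, hxR, hlt⟩ := (hB.mem_haloSet hE).1 hx
  refine (hB.mem_haloSet (measurableSet_levelHalo_of_isOpen hB.isOpen hE)).2 ⟨R, hR, hxR, ?_⟩
  by_cases hsub : R ⊆ levelHalo volume B e E
  · rw [inter_eq_left.2 hsub]
    exact ENNReal.mul_lt_of_lt_div (by
      rwa [ENNReal.div_self (hB.volume_ne_zero hR) (hB.volume_ne_top R hR), ENNReal.ofReal_lt_one])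
  · have hcoef : (K : ℝ≥0∞) * ENNReal.ofReal s ≤ (K + δ) * ENNReal.ofReal t := by
      simpa [ENNReal.ofReal_mul (add_nonneg K.coe_nonneg δ.coe_nonneg), ENNReal.ofReal_mul,
        ENNReal.ofReal_add] using ENNReal.ofReal_le_ofReal hst
    refine lt_of_mul_lt_mul_left' (a := (K : ℝ≥0∞)) ?_
    calc K * (ENNReal.ofReal s * volume R) ≤ (K + δ) * ENNReal.ofReal t * volume R := by
          rw [← mul_assoc]
          gcongr
      _ < _ := hB.mul_volume_lt_of_not_subset_levelHalo hE hR hδ hδe hsub hlt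

lemma haloFunction_of_le_one {α : ℝ} (hα : α ≤ 1) : haloFunction B α = ENNReal.ofReal α :=
  if_neg hα.not_gt

lemma haloFunction_le {α : ℝ} (hα : 1 < α) {C : ℝ≥0∞}
    (h : ∀ E, MeasurableSet E → 0 < volume E → volume E < ∞ →
      volume (haloSet B (1 / α) E) ≤ C * volume E) : haloFunction B α ≤ C := by
  rw [haloFunction, if_pos hα]
  exact iSup₂_le fun E hE => ENNReal.div_le_of_le_mul (h E hE.1 hE.2.1 hE.2.2)

lemma volume_haloSet_le {α : ℝ} (hα : 1 < α) (hE : MeasurableSet E) (hE0 : 0 < volume E)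
    (hEtop : volume E < ∞) : volume (haloSet B (1 / α) E) ≤ haloFunction B α * volume E := by
  rw [← ENNReal.div_le_iff hE0.ne' hEtop.ne, haloFunction, if_pos hα]
  exact le_iSup₂_of_le E ⟨hE, hE0, hEtop⟩ le_rfl

lemma IsHomothecyBasis.one_le_haloFunction (hB : IsHomothecyBasis B K) (hne : B.Nonempty) {α : ℝ}
    (hα : 1 < α) : 1 ≤ haloFunction B α := by
  obtain ⟨R, hR⟩ := hne
  have h0 := hB.volume_ne_zero hR
  have htop := hB.volume_ne_top R hR
  have hRm := (hB.isOpen R hR).measurableSet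
  have hsub : R ⊆ haloSet B (1 / α) R := fun x hx => by
    refine (hB.mem_haloSet hRm).2 ⟨R, hR, hx, ENNReal.mul_lt_of_lt_div ?_⟩
    rw [inter_self, ENNReal.div_self h0 htop, ENNReal.ofReal_lt_one]
    exact (div_lt_one (by positivity)).2 hα
  rw [← ENNReal.mul_le_mul_iff_left h0 htop, one_mul]
  exact (measure_mono hsub).trans (volume_haloSet_le hα hRm (pos_iff_ne_zero.2 h0) htop.lt_top)

lemma IsHomothecyBasis.monotone_haloFunction (hB : IsHomothecyBasis B K) (hne : B.Nonempty) :
    Monotone (haloFunction B) := by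
  intro α β hαβ
  rcases le_or_gt α 1 with hα | hα
  · rw [haloFunction_of_le_one hα]
    rcases le_or_gt β 1 with hβ | hβ
    · rw [haloFunction_of_le_one hβ]
      gcongr
    · exact (ENNReal.ofReal_le_one.2 hα).trans (hB.one_le_haloFunction hne hβ)
  · refine haloFunction_le hα fun E hE h0 htop =>
      (measure_mono fun x hx => ?_).trans (volume_haloSet_le (hα.trans_le hαβ) hE h0 htop)
    refine (ENNReal.ofReal_le_ofReal ?_).trans_lt hx
    gcongr

lemma IsHomothecyBasis.haloFunction_le_of_haloBound (hB : IsHomothecyBasis B K) {β : ℝ}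
    (hβ : 1 < β) {e C : ℝ≥0∞} (he : 1 ≤ ENNReal.ofReal (1 / β) + e) (h : HaloBound volume B e C) :
    haloFunction B β ≤ C :=
  haloFunction_le hβ fun E hE _ _ =>
    (measure_mono (hB.haloSet_subset_levelHalo hE he)).trans (h E hE)

lemma IsHomothecyBasis.haloFunction_le_mul_of_one_lt (hB : IsHomothecyBasis B K) {α β : ℝ}
    (hα : 1 < α) (hβ : 1 < β) {δ : ℝ≥0} (hδ : δ ≠ 0) {e C : ℝ≥0∞} (hδe : δ < e) (hC : C ≠ ∞)
    (hαβ : K * (1 / α) ≤ (K + δ) * (1 / β)) (h : HaloBound volume B e C) :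
    haloFunction B β ≤ haloFunction B α * C := by
  refine haloFunction_le hβ fun E hE hE0 hEtop => ?_
  have hα' : 1 / α < 1 := (div_lt_one (by positivity)).2 hα
  calc volume (haloSet B (1 / β) E)
      ≤ volume (haloSet B (1 / α) (levelHalo volume B e E)) :=
        measure_mono (hB.haloSet_subset_haloSet_levelHalo hE hδ hδe hα' hαβ)
    _ ≤ haloFunction B α * volume (levelHalo volume B e E) :=
        volume_haloSet_le hα (measurableSet_levelHalo_of_isOpen hB.isOpen hE)
          (hE0.trans_le (measure_mono subset_levelHalo))
          ((h E hE).trans_lt (ENNReal.mul_lt_top hC.lt_top hEtop))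
    _ ≤ haloFunction B α * (C * volume E) := by gcongr; exact h E hE
    _ = haloFunction B α * C * volume E := (mul_assoc _ _ _).symm

lemma IsHomothecyBasis.haloFunction_le_mul (hB : IsHomothecyBasis B K) (hne : B.Nonempty)
    {α β : ℝ} (hα : 1 ≤ α) (hαβ : α < β) {η : ℝ≥0} (hη : K * (β - α) < η) {C : ℝ≥0∞}
    (hC : C ≠ ∞) (h : HaloBound volume B η C) :
    haloFunction B β ≤ haloFunction B α * C := by
  have hβ : 0 < β := by linarith
  have hK : (1 : ℝ) ≤ K := mod_cast hB.one_le hne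
  rcases hα.eq_or_lt with rfl | hα
  · rw [haloFunction_of_le_one le_rfl, ENNReal.ofReal_one, one_mul]
    refine hB.haloFunction_le_of_haloBound hαβ ?_ h
    have hsum : 1 ≤ 1 / β + η := by
      have hinv : 2 - β ≤ 1 / β := by
        rw [le_div_iff₀ hβ]
        nlinarith [sq_nonneg (β - 1)]
      nlinarith
    rw [← ENNReal.ofReal_coe_nnreal, ← ENNReal.ofReal_add (by positivity) η.coe_nonneg]
    exact ENNReal.one_le_ofReal.2 hsum
  · obtain ⟨δ, hδ⟩ : ∃ δ : ℝ≥0, (δ : ℝ) = K * (β - α) :=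
      CanLift.prf _ (mul_nonneg K.coe_nonneg (sub_nonneg.2 hαβ.le))
    have hδ0 : (0 : ℝ) < δ := hδ ▸ mul_pos (by linarith) (sub_pos.2 hαβ)
    have hδη : δ < η := by rw [← NNReal.coe_lt_coe, hδ]; exact hη
    refine hB.haloFunction_le_mul_of_one_lt hα (hα.trans hαβ) (NNReal.coe_pos.1 hδ0).ne'
      (ENNReal.coe_lt_coe.2 hδη) hC ?_ h
    rw [hδ, mul_one_div, mul_one_div, div_le_div_iff₀ (by linarith) hβ]
    nlinarith [mul_nonneg (sub_nonneg.2 hα.le) (sub_nonneg.2 hαβ.le)]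

lemma IsHomothecyBasis.haloFunction_ne_top (hB : IsHomothecyBasis B K) (hne : B.Nonempty)
    {η : ℝ≥0} (hη : η ≠ 0) {C : ℝ≥0∞} (hC : C ≠ ∞) (h : HaloBound volume B η C) (α : ℝ) :
    haloFunction B α ≠ ∞ := by
  have hK : (0 : ℝ) < K := mod_cast one_pos.trans_le (hB.one_le hne)
  obtain ⟨r, hr, hrη⟩ : ∃ r : ℝ, 0 < r ∧ K * r < η := by
    refine ⟨η / (2 * K), by positivity, ?_⟩
    field_simp
    linarith [NNReal.coe_pos.2 (pos_iff_ne_zero.2 hη)]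
  have hstep (k : ℕ) : haloFunction B (1 + k * r) ≠ ∞ := by
    induction k with
    | zero => simp [haloFunction_of_le_one]
    | succ k ih =>
      have hk : 0 ≤ k * r := by positivity
      refine ne_top_of_le_ne_top (ENNReal.mul_ne_top ih hC) (hB.haloFunction_le_mul hne
        (α := 1 + k * r) ?_ ?_ ?_ hC h) <;> push_cast <;> linarith
  obtain ⟨k, hk⟩ := exists_nat_ge (α / r)
  refine ne_top_of_le_ne_top (hstep k) (hB.monotone_haloFunction hne ?_)
  linarith [(div_le_iff₀ hr).1 hk]

end HaloFunction

section LocallyHolder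

variable {F : ℝ → ℝ} {q : ℝ≥0}

lemma holderOnWith_of_monotoneOn {C : ℝ≥0} {S : Set ℝ} (hF : MonotoneOn F S)
    (h : ∀ x ∈ S, ∀ y ∈ S, x ≤ y → F y - F x ≤ C * (y - x) ^ (q : ℝ)) : HolderOnWith C q F S := by
  intro x hx y hy
  wlog hxy : x ≤ y generalizing x y
  · rw [edist_comm, edist_comm x]
    exact this y hy x hx (le_of_not_ge hxy)
  rw [edist_comm, edist_comm x, edist_dist, edist_dist,
    ENNReal.ofReal_rpow_of_nonneg dist_nonneg q.coe_nonneg, ← ENNReal.ofReal_coe_nnreal,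
    ← ENNReal.ofReal_mul C.coe_nonneg, Real.dist_eq, Real.dist_eq,
    abs_of_nonneg (sub_nonneg.2 (hF hx hy hxy)), abs_of_nonneg (sub_nonneg.2 hxy)]
  exact ENNReal.ofReal_le_ofReal (h x hx y hy hxy)

lemma exists_holderOnWith_Icc_of_monotoneOn {a b ρ C : ℝ} (hF : MonotoneOn F (Icc a b))
    (hab : a ≤ b) (hρ : 0 < ρ) (hC : 0 ≤ C)
    (h : ∀ x ∈ Icc a b, ∀ y ∈ Icc a b, x ≤ y → y - x ≤ ρ → F y - F x ≤ C * (y - x) ^ (q : ℝ)) :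
    ∃ C' : ℝ≥0, HolderOnWith C' q F (Icc a b) := by
  have hrange : 0 ≤ F b - F a :=
    sub_nonneg.2 (hF (left_mem_Icc.2 hab) (right_mem_Icc.2 hab) hab)
  refine ⟨.mk (C + (F b - F a) / ρ ^ (q : ℝ)) (by positivity),
    holderOnWith_of_monotoneOn hF fun x hx y hy hxy => ?_⟩
  have : 0 ≤ y - x := sub_nonneg.2 hxy
  rw [NNReal.coe_mk, add_mul]
  rcases le_or_gt (y - x) ρ with hsmall | hlarge
  · exact (h x hx y hy hxy hsmall).trans (le_add_of_nonneg_right (by positivity))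
  · refine le_add_of_nonneg_of_le (by positivity) ?_
    calc F y - F x ≤ F b - F a :=
          sub_le_sub (hF hy (right_mem_Icc.2 hab) hy.2) (hF (left_mem_Icc.2 hab) hx hx.1)
      _ = (F b - F a) / ρ ^ (q : ℝ) * ρ ^ (q : ℝ) := by field_simp
      _ ≤ (F b - F a) / ρ ^ (q : ℝ) * (y - x) ^ (q : ℝ) := by gcongr

lemma sub_le_mul_rpow_of_le_mul_one_add {A r : ℝ} {c : ℝ≥0} (hmono : Monotone F)
    (hid : ∀ x ∈ Icc (0 : ℝ) 1, F x = x) (hq : q ≤ 1)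
    (hF : ∀ x y, 1 ≤ x → x < y → y - x ≤ r → F y ≤ F x * (1 + c * (y - x) ^ (q : ℝ)))
    {x y : ℝ} (hx : 0 ≤ x) (hxy : x ≤ y) (hyA : y ≤ A) (hr : y - x ≤ r) (h1 : y - x ≤ 1) :
    F y - F x ≤ (1 + F A * c) * (y - x) ^ (q : ℝ) := by
  have hd : 0 ≤ y - x := sub_nonneg.2 hxy
  have hnonneg : ∀ z, 0 ≤ z → 0 ≤ F z := fun z hz =>
    (hid 0 (by simp)).symm.trans_le (hmono hz)
  have hA : 0 ≤ F A := hnonneg A (hx.trans (hxy.trans hyA))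
  have hlin : y - x ≤ (y - x) ^ (q : ℝ) := Real.self_le_rpow_of_le_one hd h1 (mod_cast hq)
  have hmul (z : ℝ) (hz : 1 ≤ z) (hxz : x ≤ z) (hzy : z ≤ y) :
      F y - F z ≤ F A * c * (y - x) ^ (q : ℝ) := by
    rcases hzy.eq_or_lt with rfl | hzy
    · rw [sub_self]
      positivity
    have : 0 ≤ y - z := sub_nonneg.2 hzy.le
    calc F y - F z ≤ F z * (c * (y - z) ^ (q : ℝ)) := by linarith [hF z y hz hzy (by linarith)]
      _ ≤ F A * (c * (y - x) ^ (q : ℝ)) := by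
          gcongr
          exact hmono (hzy.le.trans hyA)
      _ = F A * c * (y - x) ^ (q : ℝ) := (mul_assoc _ _ _).symm
  have hc : 0 ≤ F A * c * (y - x) ^ (q : ℝ) := by positivity
  rw [add_mul, one_mul]
  rcases le_total y 1 with hy1 | hy1
  · rw [hid y ⟨hx.trans hxy, hy1⟩, hid x ⟨hx, hxy.trans hy1⟩]
    linarith
  rcases le_total x 1 with hx1 | hx1
  · have hone := hmul 1 le_rfl hx1 hy1
    rw [hid 1 (by simp)] at hone
    rw [hid x ⟨hx, hx1⟩]
    linarith
  · linarith [hmul x hx1 le_rfl hxy, hd.trans hlin]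

lemma locallyHolderOn_of_le_mul_one_add {r : ℝ} {c : ℝ≥0} (hmono : Monotone F)
    (hid : ∀ x ∈ Icc (0 : ℝ) 1, F x = x) (hq : q ≤ 1) (hr : 0 < r)
    (hF : ∀ x y, 1 ≤ x → x < y → y - x ≤ r → F y ≤ F x * (1 + c * (y - x) ^ (q : ℝ))) :
    LocallyHolderOn q F (Ici 0) := by
  intro S hS hSc
  obtain ⟨A, hA⟩ := hSc.bddAbove
  have hFA : 0 ≤ F (max A 0) := (hid 0 (by simp)).symm.trans_le (hmono (le_max_right A 0))
  obtain ⟨C, hC⟩ := exists_holderOnWith_Icc_of_monotoneOn (a := 0) (b := max A 0) (ρ := min r 1)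
    (hmono.monotoneOn _) (le_max_right A 0) (lt_min hr one_pos) (by positivity)
    fun x hx y hy hxy hd => sub_le_mul_rpow_of_le_mul_one_add hmono hid hq hF hx.1 hxy hy.2
      (hd.trans (min_le_left _ _)) (hd.trans (min_le_right _ _))
  exact ⟨C, hC.mono fun x hx => ⟨hS hx, (hA hx).trans (le_max_left _ _)⟩⟩

end LocallyHolder

theorem IsHomothecyBasis.locallyHolderOn_haloFunction {n : ℕ} {B : Set (Set (Fin n → ℝ))}
    {K : ℝ≥0} (hB : IsHomothecyBasis B K) (hne : B.Nonempty) {q r c : ℝ≥0} (hq : q ≤ 1)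
    (hr : r ≠ 0)
    (h : ∀ η ≤ r, HaloBound volume B η ((1 + c * η ^ (q : ℝ) : ℝ≥0) : ℝ≥0∞)) :
    LocallyHolderOn q (fun α => (haloFunction B α).toReal) (Ici 0) := by
  have hfin := hB.haloFunction_ne_top hne hr ENNReal.coe_ne_top (h r le_rfl)
  have hK : 0 < K := one_pos.trans_le (hB.one_le hne)
  refine locallyHolderOn_of_le_mul_one_add (r := r / (2 * K)) (c := c * (2 * K) ^ (q : ℝ))
    (fun α β hαβ => ENNReal.toReal_mono (hfin β) (hB.monotone_haloFunction hne hαβ)) ?_ hq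
    (by positivity) fun α β hα hαβ hd => ?_
  · rintro α ⟨h0, h1⟩
    rw [haloFunction_of_le_one h1, ENNReal.toReal_ofReal h0]
  · obtain ⟨d, hdαβ⟩ : ∃ d : ℝ≥0, (d : ℝ) = β - α := CanLift.prf _ (sub_nonneg.2 hαβ.le)
    have hd0 : 0 < d := by rwa [← NNReal.coe_pos, hdαβ, sub_pos]
    rw [← hdαβ] at hd ⊢
    have hηr : 2 * K * d ≤ r := by
      rw [← NNReal.coe_le_coe]
      push_cast
      exact (le_div_iff₀' (by positivity)).1 hd
    have hη : K * (β - α) < (2 * K * d : ℝ≥0) := by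
      rw [← hdαβ]
      push_cast
      nlinarith [mul_pos hK hd0]
    have hle := ENNReal.toReal_mono (ENNReal.mul_ne_top (hfin α) ENNReal.coe_ne_top)
      (hB.haloFunction_le_mul hne hα hαβ hη ENNReal.coe_ne_top (h _ hηr))
    rw [ENNReal.toReal_mul, ENNReal.coe_toReal, NNReal.mul_rpow, ← mul_assoc] at hle
    exact_mod_cast hle

theorem mainTheorem6 (n : ℕ) (hn : 1 ≤ n) :
    (∀ α : ℝ, 0 ≤ α → haloFunction (strongBasis n) α < ∞) ∧
      LocallyHolderOn (1 / (n : ℝ≥0)) (fun α => (haloFunction (strongBasis n) α).toReal)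
        (Set.Ici 0) := by
  have hn0 : n ≠ 0 := Nat.one_le_iff_ne_zero.1 hn
  have hB := isHomothecyBasis_strongBasis n
  have hne : (strongBasis n).Nonempty := ⟨_, 0, 1, fun _ => zero_lt_one, rfl⟩
  have hr : (2⁻¹ : ℝ≥0) ^ n ≠ 0 := by positivity
  refine ⟨fun α _ => (hB.haloFunction_ne_top hne hr ENNReal.coe_ne_top
    (haloBound_strongBasis hn0 le_rfl) α).lt_top, hB.locallyHolderOn_haloFunction hne
      (c := n * 4 * 3 ^ n) ?_ hr fun η hη => ?_⟩
  · exact div_le_one_of_le₀ (mod_cast hn) zero_le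
  · simpa using haloBound_strongBasis hn0 hη
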